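/- Lemma 3.2. Let $D$ be a closed (orientable, connected) discrete surface of genus $g\ge 0$: a finite cell complex whose faces are polygons bounded by simple closed curves of a finite simple graph, in which every edge lies on exactly two faces and the link of every vertex is a cycle. Let $J$ be a set of sample vertices of $D$, let $A_1<\dots<A_n$ be real levels, and let a family of gradually varied paths be given in the graph of $D$, passing through all points of $J$ (that is, values are assigned to the vertices so that adjacent vertices of a path have levels $A_i,A_j$ with $|i-j|\le 1$). Let $\Gamma$ be the union of the paths, as a graph, and suppose that each vertex of $\Gamma$ has two neighbours in $\Gamma$ (exactly two; more than two, as happens where several closed paths meet, are allowed in the first part of the conclusion). Then the paths are the boundary of several manifolds: there are finitely many (at least one) compact connected discrete surfaces $M_i$, possibly with boundary, and a gluing map $\varphi:\bigsqcup_i M_i\to D$ taking vertices, edges and faces to vertices, edges and faces, such that * every face of $D$ is the image of exactly one face, the boundary cycle of each face being mapped isomorphically, and $\varphi$ is injective on the neighbours of each vertex; * every vertex and every edge of $D$ not in $\Gamma$ is the image of exactly one vertex, respectively edge; * the boundary of $\bigsqcup_i M_i$ is exactly the preimage of $\Gamma$; every edge of $\Gamma$ is the image of exactly two boundary edges, and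 every vertex of $\Gamma$ with $d$ neighbours in $\Gamma$ is the image of exactly $d$ boundary vertices. If moreover each vertex of $\Gamma$ has exactly two neighbours in $\Gamma$, then $\varphi$ is injective on every boundary curve of every $M_i$, so each boundary curve is mapped isomorphically onto one of the closed curves that make up $\Gamma$. -/

import Mathlib

universe u

/-- A compact connected discrete surface, possibly with boundary: a finite two-dimensional cell
complex whose faces are polygons (triangulations and cubical surfaces are special cases).
Its one-skeleton is the graph `G`. Each face is bounded by a simple closed curve of `G`, every edge
lies on one or two faces, and the link of every vertex is connected. The link of `v` has the
edges at `v` as nodes and the faces at `v` as arcs; a node lies on one or two arcs, so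
connectedness says that the link is a simple path or a simple cycle. -/
structure DiscreteSurface where
  V : Type u
  F : Type u
  finite_V : Finite V
  finite_F : Finite F
  nonempty_F : Nonempty F
  G : SimpleGraph V
  connected : G.Connected
  face : F → G.Subgraph
  face_connected : ∀ f, (face f).Connected
  face_regular : ∀ f, ∀ v ∈ (face f).verts, ((face f).neighborSet v).ncard = 2
  edge_faces : ∀ v w, G.Adj v w →
    {f | (face f).Adj v w}.ncard = 1 ∨ {f | (face f).Adj v w}.ncard = 2
  link_connected : ∀ v a b, G.Adj v a → G.Adj v b →
    Relation.ReflTransGen (fun x y => ∃ f, (face f).Adj v x ∧ (face f).Adj v y) a b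

namespace DiscreteSurface

/-- The boundary of the surface: the graph of all edges that lie on exactly one face.
(Its non-isolated vertices are the boundary vertices, i.e. those whose link is a path;
each of them has exactly two boundary edges, so the boundary is a disjoint union of simple
closed curves.) -/
def boundary (S : DiscreteSurface.{u}) : SimpleGraph S.V where
  Adj v w := S.G.Adj v w ∧ {f | (S.face f).Adj v w}.ncard = 1
  symm := ⟨by
    rintro v w ⟨h, h1⟩
    refine ⟨h.symm, ?_⟩
    simpa only [SimpleGraph.Subgraph.adj_comm] using h1⟩
  loopless := ⟨fun v h => S.G.loopless.irrefl v h.1⟩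

/-- A closed surface has no boundary: every edge lies on exactly two faces. -/
def IsClosed (S : DiscreteSurface.{u}) : Prop :=
  ∀ v w, S.G.Adj v w → {f | (S.face f).Adj v w}.ncard = 2

/-- Every boundary cycle of a face can be directed (`o f v w`: the edge `vw` of `f` is directed
from `v` to `w`) so that any two faces with a common edge direct it oppositely. -/
def Orientable (S : DiscreteSurface.{u}) : Prop :=
  ∃ o : S.F → S.V → S.V → Prop,
    (∀ f v w, (S.face f).Adj v w ↔ (o f v w ∨ o f w v)) ∧
    (∀ f v w, o f v w → ¬ o f w v) ∧
    (∀ f, ∀ v ∈ (S.face f).verts, ∃! w, o f v w) ∧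
    (∀ f f' v w, f ≠ f' → o f v w → (S.face f').Adj v w → o f' w v)

/-- The Euler characteristic: vertices minus edges plus faces. -/
noncomputable def eulerChar (S : DiscreteSurface.{u}) : ℤ :=
  (Nat.card S.V : ℤ) - (Nat.card S.G.edgeSet : ℤ) + (Nat.card S.F : ℤ)

/-- A closed orientable surface of genus `g`. -/
def IsClosedOfGenus (S : DiscreteSurface.{u}) (g : ℕ) : Prop :=
  S.IsClosed ∧ S.Orientable ∧ S.eulerChar = 2 - 2 * (g : ℤ)

/-- `S` is cut along the graph `Γ` into the surfaces with boundary `M i`: `S` is the disjoint union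
of the `M i` with boundary edges and boundary vertices glued together, `φ` and `ψ` are the gluing
maps on vertices and on faces, and `Γ` is what the boundaries of the `M i` are glued to. -/
structure IsCutAlong (S : DiscreteSurface.{u}) (Γ : S.G.Subgraph) {ι : Type u}
    (M : ι → DiscreteSurface.{u}) (φ : ∀ i, (M i).V → S.V) (ψ : ∀ i, (M i).F → S.F) : Prop where
  /-- The faces of `S` are partitioned among the pieces. -/
  face_bijective : Function.Bijective (fun x : Σ i, (M i).F => ψ x.1 x.2)
  /-- The boundary cycle of a face is mapped isomorphically. -/
  face_verts : ∀ i f, Set.BijOn (φ i) ((M i).face f).verts (S.face (ψ i f)).verts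
  face_adj : ∀ i f v w, ((M i).face f).Adj v w → (S.face (ψ i f)).Adj (φ i v) (φ i w)
  /-- The gluing map does not fold anything at a vertex. -/
  locally_injective : ∀ i v, Set.InjOn (φ i) ((M i).G.neighborSet v)
  /-- The boundary of the pieces is exactly what lies over `Γ`. -/
  boundary_edge : ∀ i v w, (M i).G.Adj v w →
    ((M i).boundary.Adj v w ↔ Γ.Adj (φ i v) (φ i w))
  boundary_vertex : ∀ i v, v ∈ (M i).boundary.support ↔ φ i v ∈ Γ.verts
  /-- Away from `Γ` nothing is glued. -/
  vertex_off : ∀ v, v ∉ Γ.verts → ∃! x : Σ i, (M i).V, φ x.1 x.2 = v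
  edge_off : ∀ v w, S.G.Adj v w → ¬ Γ.Adj v w →
    ∃! x : Σ i, (M i).V × (M i).V,
      (M x.1).G.Adj x.2.1 x.2.2 ∧ φ x.1 x.2.1 = v ∧ φ x.1 x.2.2 = w
  /-- Each edge of `Γ` comes from exactly two boundary edges. -/
  edge_on : ∀ v w, Γ.Adj v w →
    {x : Σ i, (M i).V × (M i).V |
      (M x.1).boundary.Adj x.2.1 x.2.2 ∧ φ x.1 x.2.1 = v ∧ φ x.1 x.2.2 = w}.ncard = 2
  /-- A vertex of `Γ` comes from as many boundary vertices as it has neighbours in `Γ`. -/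
  vertex_on : ∀ v ∈ Γ.verts,
    {x : Σ i, (M i).V | φ x.1 x.2 = v}.ncard = (Γ.neighborSet v).ncard

end DiscreteSurface

/-- With respect to the levels `A₁ < A₂ < ⋯ < Aₙ`, the values `x` and `y` are gradually varied:
if `x` is the level `A i`, then `y` is `A i` or one of the neighbouring levels. -/
def GraduallyVaried {n : ℕ} (A : Fin n → ℝ) (x y : ℝ) : Prop :=
  ∃ i j : Fin n, x = A i ∧ y = A j ∧ |(i : ℤ) - (j : ℤ)| ≤ 1

/-- A path in a graph is gradually varied for the assigned values `val` if the values at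
adjacent vertices of the path are. -/
def IsGraduallyVariedPath {V : Type u} {G : SimpleGraph V} {n : ℕ} (A : Fin n → ℝ) (val : V → ℝ)
    {a b : V} (p : G.Walk a b) : Prop :=
  ∀ v w, p.toSubgraph.Adj v w → GraduallyVaried A (val v) (val w)

/-
The edges of `Γ` at a vertex `v` cut the link of `v`, which is a cycle, into sectors: arcs of
faces that share edges outside `Γ`. The vertices of the cut open surface are the pairs of a vertex
and one of its sectors, its faces are those of `S`, and its connected components are the pieces.
With at least two edges of `Γ` at `v` there are as many sectors as such edges, and the two faces at
an edge of `Γ` lie in different sectors at both its ends, so that this edge becomes two boundary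
edges.

An orientation of `S` directs the boundary curves of the pieces. Suppose that different vertices
`a`, `b` over the same `v` lie on one curve, which leads from `a` to `b`. As `v` has only two
neighbours in `Γ`, the successor of `a` and the predecessor of `b` are again different vertices
over a common vertex. Walking on from both ends until they meet gives a contradiction, either at a
single vertex or at an edge whose ends lie over the same vertex.
-/

theorem existsUnique_mem_and_not {α : Type*} {s : Set α} (hs : s.ncard = 2) {p : α → Prop}
    (hps : ∀ a, p a → a ∈ s) (hp : ∃! a, p a) : ∃! a, a ∈ s ∧ ¬ p a := by
  obtain ⟨a, ha, hunique⟩ := hp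
  have hdiff : {b | b ∈ s ∧ ¬ p b} = s \ {a} :=
    Set.ext fun b => and_congr_right fun _ => not_congr ⟨hunique b, fun h => h ▸ ha⟩
  have hcard : {b | b ∈ s ∧ ¬ p b}.ncard = 1 := by
    rw [hdiff, Set.ncard_sdiff_singleton_of_mem (hps a ha), hs]
  obtain ⟨b, hb⟩ := Set.ncard_eq_one.1 hcard
  exact ⟨b, hb.symm.subset rfl, fun c hc => hb.subset hc⟩

theorem exists_bijective_of_biregular {α β : Type*} [Finite α] [Finite β] {r : α → β → Prop}
    {k : ℕ} (hk : 0 < k) (hα : ∀ a, {b | r a b}.ncard = k) (hβ : ∀ b, {a | r a b}.ncard = k) :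
    ∃ e : α → β, Function.Bijective e ∧ ∀ a, r a (e a) := by
  classical
  have := Fintype.ofFinite α
  have := Fintype.ofFinite β
  have hα' : ∀ a, Finset.card {b | r a b} = k := fun a => by
    rw [← hα a, Set.ncard_eq_toFinset_card', Set.toFinset_ofPred]
  have hβ' : ∀ b, Finset.card {a | r a b} = k := fun b => by
    rw [← hβ b, Set.ncard_eq_toFinset_card', Set.toFinset_ofPred]
  have hcard : Fintype.card α = Fintype.card β := by
    have h := Finset.sum_card_bipartiteAbove_eq_sum_card_bipartiteBelow (s := Finset.univ)
      (t := Finset.univ) r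
    simp only [Finset.bipartiteAbove, Finset.bipartiteBelow, hα', hβ', Finset.sum_const,
      Finset.card_univ, smul_eq_mul] at h
    exact Nat.eq_of_mul_eq_mul_right hk h
  have hall : ∀ A : Finset α, A.card ≤ Finset.card {b | ∃ a ∈ A, r a b} := fun A => by
    refine Nat.le_of_mul_le_mul_right (Finset.card_mul_le_card_mul r (fun a ha => ?_)
      fun b _ => (Finset.card_le_card (Finset.filter_subset_filter _ A.subset_univ)).trans
        (hβ' b).le) hk
    rw [← hα' a]
    refine Finset.card_le_card fun b hb => ?_
    simp only [Finset.bipartiteAbove, Finset.mem_filter, Finset.mem_univ, true_and] at hb ⊢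
    exact ⟨⟨a, ha, hb⟩, hb⟩
  obtain ⟨e, he, hr⟩ := (Fintype.all_card_le_filter_rel_iff_exists_injective r).1 hall
  exact ⟨e, (Fintype.bijective_iff_injective_and_card e).2 ⟨he, hcard⟩, hr⟩

theorem reflTransGen_total_of_biUnique {α : Type*} {r : α → α → Prop} (hr : Relator.BiUnique r)
    {a b : α} (h : Relation.ReflTransGen (Relation.SymmGen r) a b) :
    Relation.ReflTransGen r a b ∨ Relation.ReflTransGen r b a := by
  induction h with
  | refl => exact Or.inl .refl
  | tail _ hbc ih =>
    rcases ih with hab | hba <;> rcases hbc with hbc | hcb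
    · exact Or.inl (hab.tail hbc)
    · exact (Relation.ReflTransGen.total_of_right_unique (r := Function.swap r)
        (fun _ _ _ h h' => hr.1 h h') (Relation.reflTransGen_swap.2 hab) (.single hcb)).symm.imp
        Relation.reflTransGen_swap.1 Relation.reflTransGen_swap.1
    · exact (Relation.ReflTransGen.total_of_right_unique hr.2 hba (.single hbc))
    · exact Or.inr (hba.head hcb)

theorem not_rel_of_reflTransGen {α : Type*} {r opp : α → α → Prop} (hirrefl : ∀ a, ¬ opp a a)
    (hstep : ∀ ⦃a b⦄, r a b → ¬ opp a b)
    (hopp : ∀ ⦃a b c d⦄, opp a b → r a c → r d b → opp c d) {a b : α}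
    (h : Relation.ReflTransGen r a b) : ¬ opp a b := by
  obtain ⟨l, hl, hchain, rfl, rfl⟩ := List.exists_isChain_ne_nil_of_relationReflTransGen h
  clear h
  induction l using List.bidirectionalRec with
  | nil => exact absurd rfl hl
  | singleton a => exact hirrefl a
  | cons_append a l b ih =>
    intro hab
    rcases eq_or_ne l [] with rfl | hne
    · exact hstep (by simpa using hchain) (by simpa using hab)
    · obtain ⟨hhead, hchain⟩ := List.isChain_cons.1 hchain
      obtain ⟨hchain, -, hlast⟩ := List.isChain_append.1 hchain
      refine ih hne hchain (hopp (a := a) (b := b) (by simpa using hab) (hhead _ ?_)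
        (hlast _ (List.getLast_mem_getLast? hne) b rfl))
      rw [List.head?_append_of_ne_nil l hne]
      exact List.head_mem_head? hne

theorem bijective_sigma_connectedComponent {V : Type*} (G : SimpleGraph V) :
    Function.Bijective fun x : Σ C : G.ConnectedComponent, C => (x.2 : V) :=
  (Equiv.sigmaFiberEquiv G.connectedComponentMk).bijective

theorem bijOn_adj_sigma_connectedComponent {V : Type*} (G : SimpleGraph V) (p : V → V → Prop) :
    Set.BijOn (fun x : Σ C : G.ConnectedComponent, C × C => ((x.2.1 : V), (x.2.2 : V)))
      {x | x.1.toSimpleGraph.Adj x.2.1 x.2.2 ∧ p x.2.1 x.2.2} {x | G.Adj x.1 x.2 ∧ p x.1 x.2} := by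
  refine ⟨fun x hx => hx, ?_, ?_⟩
  · rintro ⟨_, ⟨a, rfl⟩, b, _⟩ _ ⟨_, ⟨a', rfl⟩, b', _⟩ _ h
    obtain ⟨rfl, rfl⟩ : a = a' ∧ b = b' := Prod.ext_iff.1 h
    rfl
  · rintro ⟨a, b⟩ ⟨hab, h⟩
    exact ⟨⟨G.connectedComponentMk a, ⟨a, rfl⟩, b,
      (SimpleGraph.ConnectedComponent.connectedComponentMk_eq_of_adj hab).symm⟩, ⟨hab, h⟩, rfl⟩

namespace DiscreteSurface

variable {S : DiscreteSurface.{u}} {Γ : S.G.Subgraph} {v w a b : S.V} {f g : S.F}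

theorem exists_face_adj (h : S.G.Adj v w) : ∃ f, (S.face f).Adj v w :=
  Set.nonempty_of_ncard_ne_zero (s := {f | (S.face f).Adj v w}) <| by
    rcases S.edge_faces v w h with h | h <;> simp only [h, ne_eq, OfNat.ofNat_ne_zero,
      one_ne_zero, not_false_eq_true]

theorem exists_adj_of_mem_face (hv : v ∈ (S.face f).verts) : ∃ w, (S.face f).Adj v w :=
  Set.nonempty_of_ncard_ne_zero ((S.face_regular f v hv).trans_ne two_ne_zero)

theorem exists_mem_face_verts (S : DiscreteSurface.{u}) (v : S.V) :
    ∃ f, v ∈ (S.face f).verts := by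
  obtain ⟨f⟩ := S.nonempty_F
  obtain ⟨a, ha⟩ := (S.face_connected f).nonempty
  obtain ⟨b, hb⟩ := exists_adj_of_mem_face ha
  have : Nontrivial S.V := ⟨a, b, hb.adj_sub.ne⟩
  obtain ⟨w, hw⟩ := S.connected.preconnected.exists_adj_of_nontrivial v
  obtain ⟨g, hg⟩ := exists_face_adj hw
  exact ⟨g, hg.fst_mem⟩

theorem mem_of_share_closed {X : Set S.F}
    (hX : ∀ f ∈ X, ∀ g w, (S.face f).Adj v w → (S.face g).Adj v w → g ∈ X)
    (hf : v ∈ (S.face f).verts) (hfX : f ∈ X) (hg : v ∈ (S.face g).verts) : g ∈ X := by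
  obtain ⟨a, ha⟩ := exists_adj_of_mem_face hf
  obtain ⟨b, hb⟩ := exists_adj_of_mem_face hg
  have hall : ∀ h, (S.face h).Adj v b → h ∈ X := by
    induction S.link_connected v a b ha.adj_sub hb.adj_sub generalizing g with
    | refl => exact fun h hh => hX f hfX h a ha hh
    | @tail b c _ hstep ih =>
      obtain ⟨k, hkb, hkc⟩ := hstep
      exact fun h hh => hX k (ih hkb.fst_mem hkb k hkb) h c hkc hh
  exact hall g hb

/-- A direction of the link of `v`: each face at `v` is left through one of its two edges at `v`
(`exit f w`: through the edge `vw`), and each edge at `v` is the exit of just one face. -/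
structure IsLinkOrientation (S : DiscreteSurface.{u}) (v : S.V) (exit : S.F → S.V → Prop) :
    Prop where
  adj : ∀ {f w}, exit f w → (S.face f).Adj v w
  existsUnique_exit : ∀ {f}, v ∈ (S.face f).verts → ∃! w, exit f w
  existsUnique_face : ∀ {w}, S.G.Adj v w → ∃! f, exit f w

theorem exists_isLinkOrientation (hS : S.IsClosed) (v : S.V) :
    ∃ exit, S.IsLinkOrientation v exit := by
  have := S.finite_V
  have := S.finite_F
  have hface : ∀ f : {f // v ∈ (S.face f).verts},
      {w : S.G.neighborSet v | (S.face f).Adj v w}.ncard = 2 := fun f => by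
    rw [← S.face_regular f v f.2]
    exact Set.BijOn.ncard_eq ⟨fun w hw => hw, Subtype.val_injective.injOn,
      fun w hw => ⟨⟨w, SimpleGraph.Subgraph.Adj.adj_sub hw⟩, hw, rfl⟩⟩
  have hedge : ∀ w : S.G.neighborSet v,
      {f : {f // v ∈ (S.face f).verts} | (S.face f).Adj v w}.ncard = 2 := fun w => by
    rw [← hS v w w.2]
    exact Set.BijOn.ncard_eq ⟨fun f hf => hf, Subtype.val_injective.injOn,
      fun f hf => ⟨⟨f, SimpleGraph.Subgraph.Adj.fst_mem hf⟩, hf, rfl⟩⟩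
  obtain ⟨e, he, hadj⟩ := exists_bijective_of_biregular two_pos hface hedge
  refine ⟨fun f w => ∃ hf, e ⟨f, hf⟩ = w, ?_, fun hf => ⟨_, ⟨hf, rfl⟩, ?_⟩, fun hw => ?_⟩
  · rintro f _ ⟨hf, rfl⟩
    exact hadj ⟨f, hf⟩
  · rintro _ ⟨-, rfl⟩
    rfl
  · obtain ⟨f, hf⟩ := he.2 ⟨_, hw⟩
    refine ⟨f, ⟨f.2, congrArg Subtype.val hf⟩, ?_⟩
    rintro g ⟨hg, hgw⟩
    exact congrArg Subtype.val (he.1 ((Subtype.ext hgw).trans hf.symm) : ⟨g, hg⟩ = f)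

variable (Γ) in
/-- The faces `f` and `g` share an edge at `v` that does not lie in `Γ`. -/
def UncutStep (v : S.V) (f g : S.F) : Prop :=
  ∃ w, ¬ Γ.Adj v w ∧ (S.face f).Adj v w ∧ (S.face g).Adj v w

variable (Γ) in
/-- The faces `f` and `g` lie in the same sector at `v`: the edges of `Γ` at `v` cut the link of
`v` into sectors, and each sector gives rise to one copy of `v`. -/
def SameSector (v : S.V) : S.F → S.F → Prop :=
  Relation.ReflTransGen (UncutStep Γ v)

theorem SameSector.symm (h : SameSector Γ v f g) : SameSector Γ v g f :=
  have : Std.Symm (UncutStep Γ v) := ⟨fun _ _ ⟨w, h, hf, hg⟩ => ⟨w, h, hg, hf⟩⟩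
  Relation.ReflTransGen.stdSymm.symm _ _ h

theorem SameSector.mem_verts (h : SameSector Γ v f g) (hf : v ∈ (S.face f).verts) :
    v ∈ (S.face g).verts := by
  induction h with
  | refl => exact hf
  | tail _ h =>
    obtain ⟨w, -, -, hw⟩ := h
    exact hw.fst_mem

theorem sameSector_of_notMem (hv : v ∉ Γ.verts) (hf : v ∈ (S.face f).verts)
    (hg : v ∈ (S.face g).verts) : SameSector Γ v f g :=
  mem_of_share_closed (X := {g | SameSector Γ v f g})
    (fun _ hh _ w hw hw' => hh.tail ⟨w, fun h => hv h.fst_mem, hw, hw'⟩) hf .refl hg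

namespace IsLinkOrientation

variable {exit : S.F → S.V → Prop}

theorem exit_unique (he : S.IsLinkOrientation v exit) (ha : exit f a) (hb : exit f b) : a = b :=
  (he.existsUnique_exit (he.adj ha).fst_mem).unique ha hb

theorem face_unique (he : S.IsLinkOrientation v exit) (hf : exit f w) (hg : exit g w) : f = g :=
  (he.existsUnique_face (he.adj hf).adj_sub).unique hf hg

theorem reverse (hS : S.IsClosed) (he : S.IsLinkOrientation v exit) :
    S.IsLinkOrientation v fun f w => (S.face f).Adj v w ∧ ¬ exit f w where
  adj h := h.1
  existsUnique_exit hv :=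
    existsUnique_mem_and_not (S.face_regular _ v hv) (fun _ => he.adj) (he.existsUnique_exit hv)
  existsUnique_face hw :=
    existsUnique_mem_and_not (hS v _ hw) (fun _ => he.adj) (he.existsUnique_face hw)

theorem mem_of_turn_closed (hS : S.IsClosed) (he : S.IsLinkOrientation v exit) {X : Set S.F}
    (hX : ∀ f ∈ X, v ∈ (S.face f).verts)
    (hturn : ∀ f ∈ X, ∀ w, exit f w → ∀ g, (S.face g).Adj v w → g ∈ X) (hfX : f ∈ X)
    (hg : v ∈ (S.face g).verts) : g ∈ X := by
  have := S.finite_F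
  have hnext : ∀ f : X, ∃ g : X, ∃ w, exit f w ∧ (S.face g).Adj v w ∧ ¬ exit g w := fun f => by
    obtain ⟨w, hw, -⟩ := he.existsUnique_exit (hX f f.2)
    obtain ⟨g, hg, -⟩ := (he.reverse hS).existsUnique_face (he.adj hw).adj_sub
    exact ⟨⟨g, hturn f f.2 w hw g hg.1⟩, w, hw, hg⟩
  choose next edge hexit hentry using hnext
  have hinj : Function.Injective next := fun f g hfg => by
    have hedge := (he.reverse hS).exit_unique (hentry f) (hfg ▸ hentry g)
    exact Subtype.ext (he.face_unique (hexit f) (hedge ▸ hexit g))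
  have hsurj := Finite.surjective_of_injective hinj
  refine mem_of_share_closed (fun f hf g w hfw hgw => ?_) (hX f hfX) hfX hg
  by_cases hw : exit f w
  · exact hturn f hf w hw g hgw
  · obtain ⟨h, hh⟩ := hsurj ⟨f, hf⟩
    have hedge : edge h = w := (he.reverse hS).exit_unique (hentry h) (by rw [hh]; exact ⟨hfw, hw⟩)
    exact hturn h h.2 w (hedge ▸ hexit h) g hgw

theorem exists_exit_cut (hS : S.IsClosed) (he : S.IsLinkOrientation v exit) (hw : Γ.Adj v w)
    (hf : v ∈ (S.face f).verts) : ∃ g a, SameSector Γ v f g ∧ exit g a ∧ Γ.Adj v a := by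
  by_contra! hno
  obtain ⟨g, hg, -⟩ := he.existsUnique_face hw.adj_sub
  have hfg : g ∈ {g | SameSector Γ v f g} :=
    he.mem_of_turn_closed hS (fun _ hh => hh.mem_verts hf)
      (fun h hh a ha _ hk => hh.tail ⟨a, hno h a hh ha, he.adj ha, hk⟩) .refl (he.adj hg).fst_mem
  exact hno g w hfg hg hw

variable (Γ v exit) in
/-- `g` follows `f` around `v` in the direction `exit`, across an edge outside `Γ`. -/
def TurnStep (f g : S.F) : Prop :=
  ∃ w, ¬ Γ.Adj v w ∧ exit f w ∧ (S.face g).Adj v w ∧ ¬ exit g w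

theorem biUnique_turnStep (hS : S.IsClosed) (he : S.IsLinkOrientation v exit) :
    Relator.BiUnique (TurnStep Γ v exit) := by
  constructor
  · rintro f g h ⟨a, -, hfa, hha⟩ ⟨b, -, hgb, hhb⟩
    obtain rfl := (he.reverse hS).exit_unique hha hhb
    exact he.face_unique hfa hgb
  · rintro f g h ⟨a, -, hfa, hga⟩ ⟨b, -, hfb, hhb⟩
    obtain rfl := he.exit_unique hfa hfb
    exact (he.reverse hS).face_unique hga hhb

theorem exit_cut_unique (hS : S.IsClosed) (he : S.IsLinkOrientation v exit)
    (hfg : SameSector Γ v f g) (hfa : exit f a) (ha : Γ.Adj v a) (hgb : exit g b)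
    (hb : Γ.Adj v b) : f = g := by
  have hpath : Relation.ReflTransGen (Relation.SymmGen (TurnStep Γ v exit)) f g := by
    refine Relation.reflTransGen_closed (r := UncutStep Γ v) ?_ f g hfg
    rintro h k ⟨w, hw, hhw, hkw⟩
    by_cases hh : exit h w <;> by_cases hk : exit k w
    · exact he.face_unique hh hk ▸ .refl
    · exact .single (Or.inl ⟨w, hw, hh, hkw, hk⟩)
    · exact .single (Or.inr ⟨w, hw, hk, hhw, hh⟩)
    · exact (he.reverse hS).face_unique ⟨hhw, hh⟩ ⟨hkw, hk⟩ ▸ .refl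
  have hlast : ∀ {h c}, exit h c → Γ.Adj v c → ∀ k, ¬ TurnStep Γ v exit h k := by
    rintro h c hc hcut k ⟨w, hw, hhw, -⟩
    exact hw (he.exit_unique hc hhw ▸ hcut)
  rcases reflTransGen_total_of_biUnique (he.biUnique_turnStep hS) hpath with h | h <;>
    rcases h.cases_head with heq | ⟨k, hk, -⟩
  · exact heq
  · exact absurd hk (hlast hfa ha k)
  · exact heq.symm
  · exact absurd hk (hlast hgb hb k)

theorem not_sameSector (hS : S.IsClosed) (he : S.IsLinkOrientation v exit)
    (hv : 2 ≤ (Γ.neighborSet v).ncard) (hw : Γ.Adj v w) (hf : exit f w)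
    (hg : (S.face g).Adj v w) (hg' : ¬ exit g w) : ¬ SameSector Γ v f g := fun hfg => by
  obtain ⟨b, hb, hne⟩ := Set.exists_ne_of_one_lt_ncard hv w
  obtain ⟨k, hk, -⟩ := he.existsUnique_face (Γ.adj_sub hb)
  have hfk : k ∈ {k | SameSector Γ v f k} := by
    refine he.mem_of_turn_closed hS (fun h hh => hh.mem_verts (he.adj hf).fst_mem)
      (fun h hh a ha l hl => ?_) .refl (he.adj hk).fst_mem
    by_cases hcut : Γ.Adj v a
    · obtain rfl := he.exit_cut_unique hS hh hf hw ha hcut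
      obtain rfl := he.exit_unique hf ha
      by_cases hlw : exit l w
      · exact he.face_unique hf hlw ▸ .refl
      · exact (he.reverse hS).face_unique ⟨hg, hg'⟩ ⟨hl, hlw⟩ ▸ hfg
    · exact hh.tail ⟨a, hcut, he.adj ha, hl⟩
  obtain rfl := he.exit_cut_unique hS hfk hf hw hk hb
  exact hne (he.exit_unique hk hf)

end IsLinkOrientation

theorem SameSector.eq_of_adj (hS : S.IsClosed) (hv : 2 ≤ (Γ.neighborSet v).ncard)
    (hfg : SameSector Γ v f g) (hw : Γ.Adj v w) (hf : (S.face f).Adj v w)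
    (hg : (S.face g).Adj v w) : f = g := by
  obtain ⟨exit, he⟩ := exists_isLinkOrientation hS v
  by_cases hf' : exit f w <;> by_cases hg' : exit g w
  · exact he.face_unique hf' hg'
  · exact absurd hfg (he.not_sameSector hS hv hw hf' hg hg')
  · exact absurd hfg.symm (he.not_sameSector hS hv hw hg' hf hf')
  · exact (he.reverse hS).face_unique ⟨hf, hf'⟩ ⟨hg, hg'⟩

/-- A vertex of the surface cut open along `Γ`: a vertex of `S` with one of its sectors. -/
@[ext]
structure CutVertex (Γ : S.G.Subgraph) where
  base : S.V
  sector : Set S.F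
  exists_eq : ∃ f, base ∈ (S.face f).verts ∧ sector = {g | SameSector Γ base f g}

namespace CutVertex

instance : Finite (CutVertex Γ) :=
  have := S.finite_V
  have := S.finite_F
  Finite.of_injective (fun x : CutVertex Γ => (x.base, x.sector)) fun _ _ h =>
    CutVertex.ext (congrArg Prod.fst h) (congrArg Prod.snd h)

variable (Γ) in
/-- The copy of the vertex `v` to which its face `f` is attached. -/
def corner (hv : v ∈ (S.face f).verts) : CutVertex Γ where
  base := v
  sector := {g | SameSector Γ v f g}
  exists_eq := ⟨f, hv, rfl⟩

theorem mem_sector_corner (hv : v ∈ (S.face f).verts) : f ∈ (corner Γ hv).sector :=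
  Relation.ReflTransGen.refl

variable {x y : CutVertex Γ}

theorem exists_mem (x : CutVertex Γ) : ∃ f, f ∈ x.sector := by
  obtain ⟨f, -, hs⟩ := x.exists_eq
  exact ⟨f, hs ▸ Relation.ReflTransGen.refl⟩

theorem base_mem (hf : f ∈ x.sector) : x.base ∈ (S.face f).verts := by
  obtain ⟨g, hg, hs⟩ := x.exists_eq
  exact SameSector.mem_verts (hs.subset hf) hg

theorem mem_sector_iff (hf : f ∈ x.sector) : g ∈ x.sector ↔ SameSector Γ x.base f g := by
  obtain ⟨h, -, hs⟩ := x.exists_eq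
  rw [hs] at hf ⊢
  exact ⟨fun hg => (SameSector.symm hf).trans hg, fun hg => hf.trans hg⟩

theorem eq_of_mem (h : x.base = y.base) (hx : f ∈ x.sector) (hy : f ∈ y.sector) : x = y :=
  CutVertex.ext h <| Set.ext fun g => by rw [mem_sector_iff hx, mem_sector_iff hy, h]

theorem mem_sector_of_adj (hfx : f ∈ x.sector) (hw : ¬ Γ.Adj x.base w)
    (hf : (S.face f).Adj x.base w) (hg : (S.face g).Adj x.base w) : g ∈ x.sector :=
  (mem_sector_iff hfx).2 (.single ⟨w, hw, hf, hg⟩)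

theorem face_unique (hS : S.IsClosed) (h2 : ∀ v ∈ Γ.verts, 2 ≤ (Γ.neighborSet v).ncard)
    (hw : Γ.Adj x.base w) (hf : (S.face f).Adj x.base w) (hg : (S.face g).Adj x.base w)
    (hfx : f ∈ x.sector) (hgx : g ∈ x.sector) : f = g :=
  ((mem_sector_iff hfx).1 hgx).eq_of_adj hS (h2 _ hw.fst_mem) hw hf hg

theorem existsUnique_base_eq (hv : v ∉ Γ.verts) : ∃! x : CutVertex Γ, x.base = v := by
  obtain ⟨f, hf⟩ := S.exists_mem_face_verts v
  refine ⟨corner Γ hf, rfl, ?_⟩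
  rintro y rfl
  obtain ⟨g, hg⟩ := y.exists_mem
  exact eq_of_mem rfl hg (sameSector_of_notMem hv hf (base_mem hg))

theorem exists_exit_cut (hS : S.IsClosed) {exit : S.F → S.V → Prop}
    (he : S.IsLinkOrientation x.base exit) (hw : Γ.Adj x.base w) :
    ∃ f ∈ x.sector, ∃ a, exit f a ∧ Γ.Adj x.base a := by
  obtain ⟨f, hf⟩ := x.exists_mem
  obtain ⟨g, a, hg, ha⟩ := he.exists_exit_cut hS hw (base_mem hf)
  exact ⟨g, (mem_sector_iff hf).2 hg, a, ha⟩

theorem ncard_base_eq (hS : S.IsClosed) (hw : Γ.Adj v w) :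
    {x : CutVertex Γ | x.base = v}.ncard = (Γ.neighborSet v).ncard := by
  obtain ⟨exit, he⟩ := exists_isLinkOrientation hS v
  choose face hface using fun a (ha : a ∈ Γ.neighborSet v) =>
    (he.existsUnique_face (Γ.adj_sub ha)).exists
  refine (Set.ncard_congr (fun a ha => corner Γ (he.adj (hface a ha)).fst_mem) (fun _ _ => rfl)
    (fun a b ha hb hab => ?_) ?_).symm
  · have hsector : SameSector Γ v (face a ha) (face b hb) :=
      (congrArg sector hab).superset (mem_sector_corner _)
    have hfaces := he.exit_cut_unique hS hsector (hface a ha) ha (hface b hb) hb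
    exact he.exit_unique (hface a ha) (hfaces ▸ hface b hb)
  · rintro x rfl
    obtain ⟨f, hf, a, hfa, ha⟩ := exists_exit_cut hS he hw
    refine ⟨a, ha, eq_of_mem rfl (mem_sector_corner _) ?_⟩
    rwa [he.face_unique (hface a ha) hfa]

end CutVertex

open CutVertex

variable (Γ) in
/-- The one-skeleton of the surface cut open along `Γ`. -/
def cutGraph : SimpleGraph (CutVertex Γ) where
  Adj x y := ∃ f, (S.face f).Adj x.base y.base ∧ f ∈ x.sector ∧ f ∈ y.sector
  symm := ⟨fun _ _ ⟨f, h, hx, hy⟩ => ⟨f, h.symm, hy, hx⟩⟩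
  loopless := ⟨fun _ ⟨_, h, _, _⟩ => h.ne rfl⟩

theorem injOn_base_neighborSet (hS : S.IsClosed)
    (h2 : ∀ v ∈ Γ.verts, 2 ≤ (Γ.neighborSet v).ncard) (x : CutVertex Γ) :
    Set.InjOn CutVertex.base ((cutGraph Γ).neighborSet x) := by
  rintro y ⟨f, hf, hfx, hfy⟩ z ⟨g, hg, hgx, hgz⟩ h
  rw [← h] at hg
  refine eq_of_mem h (f := g) ?_ hgz
  by_cases hcut : Γ.Adj x.base y.base
  · rwa [← face_unique hS h2 hcut hf hg hfx hgx]
  · exact mem_sector_of_adj hfy (fun h => hcut h.symm) hf.symm hg.symm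

theorem existsUnique_cutGraph_adj (h : S.G.Adj v w) (hcut : ¬ Γ.Adj v w) :
    ∃! p : CutVertex Γ × CutVertex Γ, (cutGraph Γ).Adj p.1 p.2 ∧ p.1.base = v ∧ p.2.base = w := by
  obtain ⟨f, hf⟩ := exists_face_adj h
  refine ⟨(corner Γ hf.fst_mem, corner Γ hf.snd_mem),
    ⟨⟨f, hf, mem_sector_corner hf.fst_mem, mem_sector_corner hf.snd_mem⟩, rfl, rfl⟩, ?_⟩
  rintro ⟨x, y⟩ ⟨⟨g, hg, hgx, hgy⟩, rfl, rfl⟩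
  exact Prod.ext (eq_of_mem rfl (mem_sector_of_adj hgx hcut hg hf) (mem_sector_corner hf.fst_mem))
    (eq_of_mem rfl (mem_sector_of_adj hgy (fun h => hcut h.symm) hg.symm hf.symm)
      (mem_sector_corner hf.snd_mem))

theorem ncard_cutGraph_adj (hS : S.IsClosed) (h2 : ∀ v ∈ Γ.verts, 2 ≤ (Γ.neighborSet v).ncard)
    (hcut : Γ.Adj v w) :
    {p : CutVertex Γ × CutVertex Γ |
      (cutGraph Γ).Adj p.1 p.2 ∧ p.1.base = v ∧ p.2.base = w}.ncard = 2 := by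
  rw [← hS v w hcut.adj_sub]
  refine (Set.ncard_congr (fun f (hf : (S.face f).Adj v w) =>
    (corner Γ hf.fst_mem, corner Γ hf.snd_mem)) (fun f (hf : (S.face f).Adj v w) => ?_)
    (fun f g hf hg hfg => ?_) ?_).symm
  · exact ⟨⟨f, hf, mem_sector_corner hf.fst_mem, mem_sector_corner hf.snd_mem⟩, rfl, rfl⟩
  · have hsector : SameSector Γ v f g :=
      (congrArg (sector ∘ Prod.fst) hfg).superset
        (mem_sector_corner (SimpleGraph.Subgraph.Adj.fst_mem hg))
    exact hsector.eq_of_adj hS (h2 v hcut.fst_mem) hcut hf hg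
  · rintro ⟨x, y⟩ ⟨⟨f, hf, hfx, hfy⟩, rfl, rfl⟩
    exact ⟨f, hf, Prod.ext (eq_of_mem rfl (mem_sector_corner hf.fst_mem) hfx)
      (eq_of_mem rfl (mem_sector_corner hf.snd_mem) hfy)⟩

variable (Γ f) in
/-- The boundary walk of the face `f`, lifted to the surface cut open along `Γ`. -/
def faceHom : (S.face f).coe →g cutGraph Γ where
  toFun v := corner Γ v.2
  map_rel' {v w} h := ⟨f, h, mem_sector_corner v.2, mem_sector_corner w.2⟩

theorem mem_sector_faceHom (v : (S.face f).verts) : f ∈ (faceHom Γ f v).sector :=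
  mem_sector_corner v.2

theorem eq_faceHom {x : CutVertex Γ} (hf : f ∈ x.sector) :
    x = faceHom Γ f ⟨x.base, base_mem hf⟩ :=
  eq_of_mem rfl hf (mem_sector_faceHom ⟨x.base, base_mem hf⟩)

theorem reachable_of_mem_sector {x y : CutVertex Γ} (hx : f ∈ x.sector) (hy : f ∈ y.sector) :
    (cutGraph Γ).Reachable x y := by
  rw [eq_faceHom hx, eq_faceHom hy]
  exact ((S.face_connected f).preconnected _ _).map (faceHom Γ f)

variable (Γ f) in
/-- The connected component of the cut open surface that contains the face `f`. -/
noncomputable def faceComponent : (cutGraph Γ).ConnectedComponent :=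
  (cutGraph Γ).connectedComponentMk (faceHom Γ f (S.face_connected f).coe.nonempty.some)

theorem faceComponent_eq {x : CutVertex Γ} (hf : f ∈ x.sector) :
    faceComponent Γ f = (cutGraph Γ).connectedComponentMk x :=
  SimpleGraph.ConnectedComponent.sound (reachable_of_mem_sector (mem_sector_faceHom _) hf)

section Piece

variable {C : (cutGraph Γ).ConnectedComponent}

theorem faceComponent_eq_of_mem {x : C} (hf : f ∈ x.1.sector) : faceComponent Γ f = C :=
  (faceComponent_eq hf).trans x.2

theorem exists_mem_sector (hf : faceComponent Γ f = C) (hv : v ∈ (S.face f).verts) :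
    ∃ x : C, x.1.base = v ∧ f ∈ x.1.sector :=
  ⟨⟨corner Γ hv, (faceComponent_eq (mem_sector_corner hv)).symm.trans hf⟩, rfl,
    mem_sector_corner hv⟩

variable (C) in
/-- The boundary cycle of the face `f` in the component `C` of the cut open surface (empty if `f`
is not a face of `C`). -/
def pieceFace (f : S.F) : C.toSimpleGraph.Subgraph where
  verts := {x | f ∈ x.1.sector}
  Adj x y := (S.face f).Adj x.1.base y.1.base ∧ f ∈ x.1.sector ∧ f ∈ y.1.sector
  adj_sub h := ⟨f, h⟩
  edge_vert h := h.2.1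
  symm := ⟨fun _ _ ⟨h, hx, hy⟩ => ⟨h.symm, hy, hx⟩⟩

theorem bijOn_pieceFace (hf : faceComponent Γ f = C) :
    Set.BijOn (fun x : C => x.1.base) (pieceFace C f).verts (S.face f).verts :=
  ⟨fun _ => base_mem, fun _ hx _ hy h => Subtype.ext (eq_of_mem h hx hy),
    fun _ hv => (exists_mem_sector hf hv).imp fun _ h => h.symm⟩

theorem pieceFace_connected (hf : faceComponent Γ f = C) : (pieceFace C f).Connected := by
  have hC : ∀ v, faceHom Γ f v ∈ C := fun v =>
    (faceComponent_eq (mem_sector_faceHom v)).symm.trans hf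
  refine ⟨(S.face_connected f).coe.map
    (⟨fun v => ⟨⟨faceHom Γ f v, hC v⟩, mem_sector_faceHom v⟩,
      fun {v w} h => ⟨h, mem_sector_faceHom v, mem_sector_faceHom w⟩⟩ :
      (S.face f).coe →g (pieceFace C f).coe) fun x => ?_⟩
  exact ⟨⟨x.1.1.base, base_mem x.2⟩, Subtype.ext (Subtype.ext (eq_faceHom x.2).symm)⟩

theorem pieceFace_regular (hf : faceComponent Γ f = C) (x : C) (hx : x ∈ (pieceFace C f).verts) :
    ((pieceFace C f).neighborSet x).ncard = 2 := by
  rw [← S.face_regular f x.1.base (base_mem hx)]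
  refine Set.BijOn.ncard_eq (f := fun y : C => y.1.base) ⟨fun y hy => hy.1,
    (bijOn_pieceFace hf).injOn.mono fun y hy => hy.2.2, fun w hw => ?_⟩
  obtain ⟨y, rfl, hy⟩ := exists_mem_sector hf (SimpleGraph.Subgraph.Adj.snd_mem hw)
  exact ⟨y, ⟨hw, hx, hy⟩, rfl⟩

theorem piece_link_connected {x a b : C} (ha : C.toSimpleGraph.Adj x a)
    (hb : C.toSimpleGraph.Adj x b) :
    Relation.ReflTransGen (fun y z => ∃ f : {f // faceComponent Γ f = C},
      (pieceFace C f.1).Adj x y ∧ (pieceFace C f.1).Adj x z) a b := by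
  obtain ⟨f, hf, hfx, hfa⟩ := ha
  obtain ⟨g, hg, hgx, hgb⟩ := hb
  have hfg := (mem_sector_iff hfx).1 hgx
  clear hgx
  induction hfg generalizing b with
  | refl =>
    exact .single ⟨⟨f, faceComponent_eq_of_mem hfx⟩, ⟨hf, hfx, hfa⟩, hg, hfx, hgb⟩
  | @tail g k hfg hstep ih =>
    have hgx : g ∈ x.1.sector := (mem_sector_iff hfx).2 hfg
    obtain ⟨w, hw, hgw, hkw⟩ := hstep
    obtain ⟨c, rfl, hgc⟩ := exists_mem_sector (faceComponent_eq_of_mem hgx) hgw.snd_mem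
    have hkx := mem_sector_of_adj hgx hw hgw hkw
    have hkc := mem_sector_of_adj hgc (fun h => hw h.symm) hgw.symm hkw.symm
    exact (ih hgw hgc).tail
      ⟨⟨k, faceComponent_eq_of_mem hkx⟩, ⟨hkw, hkx, hkc⟩, hg, hkx, hgb⟩

theorem ncard_pieceFace_of_cut (hS : S.IsClosed)
    (h2 : ∀ v ∈ Γ.verts, 2 ≤ (Γ.neighborSet v).ncard) {x y : C} (h : C.toSimpleGraph.Adj x y)
    (hcut : Γ.Adj x.1.base y.1.base) :
    {f : {f // faceComponent Γ f = C} | (pieceFace C f.1).Adj x y}.ncard = 1 := by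
  obtain ⟨f, hf, hx, hy⟩ := h
  refine Set.ncard_eq_one.2 ⟨⟨f, faceComponent_eq_of_mem hx⟩, Set.ext fun g => ⟨fun hg => ?_, ?_⟩⟩
  · exact Subtype.ext (face_unique hS h2 hcut hg.1 hf hg.2.1 hx)
  · rintro rfl
    exact ⟨hf, hx, hy⟩

theorem ncard_pieceFace_of_not_cut (hS : S.IsClosed) {x y : C} (h : C.toSimpleGraph.Adj x y)
    (hcut : ¬ Γ.Adj x.1.base y.1.base) :
    {f : {f // faceComponent Γ f = C} | (pieceFace C f.1).Adj x y}.ncard = 2 := by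
  obtain ⟨f, hf, hx, hy⟩ := h
  rw [← hS x.1.base y.1.base hf.adj_sub]
  refine Set.BijOn.ncard_eq (f := Subtype.val) ⟨fun g hg => hg.1,
    Subtype.val_injective.injOn, fun g hg => ?_⟩
  have hgx := mem_sector_of_adj hx hcut hf hg
  have hgy := mem_sector_of_adj hy (fun h => hcut h.symm) hf.symm (SimpleGraph.Subgraph.Adj.symm hg)
  exact ⟨⟨g, faceComponent_eq_of_mem hgx⟩, ⟨hg, hgx, hgy⟩, rfl⟩

end Piece

section

variable (hS : S.IsClosed) (h2 : ∀ v ∈ Γ.verts, 2 ≤ (Γ.neighborSet v).ncard)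

/-- A component of the closed surface `S` cut open along `Γ`, as a surface with boundary. -/
def piece (C : (cutGraph Γ).ConnectedComponent) : DiscreteSurface.{u} where
  V := C
  F := {f // faceComponent Γ f = C}
  finite_V := inferInstanceAs (Finite {x // x ∈ C})
  finite_F := have := S.finite_F; inferInstance
  nonempty_F := by
    obtain ⟨x, rfl⟩ := C.exists_rep
    obtain ⟨f, hf⟩ := x.exists_mem
    exact ⟨⟨f, faceComponent_eq hf⟩⟩
  G := C.toSimpleGraph
  connected := C.connected_toSimpleGraph
  face f := pieceFace C f.1
  face_connected f := pieceFace_connected f.2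
  face_regular f := pieceFace_regular f.2
  edge_faces x y h := by
    by_cases hcut : Γ.Adj x.1.base y.1.base
    · exact Or.inl (ncard_pieceFace_of_cut hS h2 h hcut)
    · exact Or.inr (ncard_pieceFace_of_not_cut hS h hcut)
  link_connected _ _ _ := piece_link_connected

variable {C : (cutGraph Γ).ConnectedComponent} {x y : C}

theorem piece_boundary_adj_iff :
    (piece hS h2 C).boundary.Adj x y ↔
      C.toSimpleGraph.Adj x y ∧ Γ.Adj x.1.base y.1.base := by
  refine ⟨fun h => ⟨h.1, ?_⟩, fun h => ⟨h.1, ncard_pieceFace_of_cut hS h2 h.1 h.2⟩⟩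
  by_contra hcut
  exact absurd (h.2.symm.trans (ncard_pieceFace_of_not_cut hS h.1 hcut)) (by decide)

theorem mem_support_piece_boundary_iff :
    x ∈ (piece hS h2 C).boundary.support ↔ x.1.base ∈ Γ.verts := by
  refine ⟨fun ⟨y, h⟩ => ((piece_boundary_adj_iff hS h2).1 h).2.fst_mem, fun hx => ?_⟩
  obtain ⟨exit, he⟩ := exists_isLinkOrientation hS x.1.base
  obtain ⟨w, hw⟩ := Set.nonempty_of_ncard_ne_zero (two_pos.trans_le (h2 _ hx)).ne'
  obtain ⟨f, hf, a, ha, hcut⟩ := exists_exit_cut hS he hw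
  obtain ⟨y, rfl, hy⟩ := exists_mem_sector (faceComponent_eq_of_mem hf) (he.adj ha).snd_mem
  exact ⟨y, (piece_boundary_adj_iff hS h2).2 ⟨⟨f, he.adj ha, hf, hy⟩, hcut⟩⟩

theorem isCutAlong_piece :
    S.IsCutAlong Γ (piece hS h2) (fun _ x => x.1.base) (fun _ f => f.1) where
  face_bijective := (Equiv.sigmaFiberEquiv (faceComponent Γ)).bijective
  face_verts _ f := bijOn_pieceFace f.2
  face_adj _ _ _ _ h := h.1
  locally_injective _ x _ hy _ hz h :=
    Subtype.ext (injOn_base_neighborSet hS h2 x.1 hy hz h)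
  boundary_edge _ _ _ h := (piece_boundary_adj_iff hS h2).trans (and_iff_right h)
  boundary_vertex _ _ := mem_support_piece_boundary_iff hS h2
  vertex_off v hv := (bijective_sigma_connectedComponent (cutGraph Γ)).existsUnique_iff.1
    (existsUnique_base_eq hv)
  edge_off v w h hcut := by
    have hbij := bijOn_adj_sigma_connectedComponent (cutGraph Γ)
      fun x y => x.base = v ∧ y.base = w
    obtain ⟨p, hp, hunique⟩ := existsUnique_cutGraph_adj h hcut
    obtain ⟨x, hx, rfl⟩ := hbij.surjOn hp
    exact ⟨x, hx, fun y hy => hbij.injOn hy hx (hunique _ (hbij.mapsTo hy))⟩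
  edge_on v w hcut := by
    rw [← ncard_cutGraph_adj hS h2 hcut, ← (bijOn_adj_sigma_connectedComponent (cutGraph Γ)
      fun x y => x.base = v ∧ y.base = w).ncard_eq]
    refine congrArg Set.ncard (Set.ext fun x => and_congr_left fun h => ?_)
    exact (piece_boundary_adj_iff hS h2).trans (and_iff_left (by rwa [h.1, h.2]))
  vertex_on v hv := by
    have hbij := bijective_sigma_connectedComponent (cutGraph Γ)
    obtain ⟨w, hw⟩ := Set.nonempty_of_ncard_ne_zero (two_pos.trans_le (h2 v hv)).ne'
    rw [← ncard_base_eq hS hw]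
    exact Set.ncard_preimage_of_injective_subset_range (s := {x : CutVertex Γ | x.base = v})
      hbij.injective fun x _ => hbij.surjective x

end

/-- `o` is an orientation of the surface: it directs the boundary cycle of every face (`o f v w`:
the edge `vw` of `f` is directed from `v` to `w`) as in the definition of `Orientable`. -/
structure IsOrientation (S : DiscreteSurface.{u}) (o : S.F → S.V → S.V → Prop) : Prop where
  adj_iff : ∀ f v w, (S.face f).Adj v w ↔ (o f v w ∨ o f w v)
  asymm : ∀ f v w, o f v w → ¬ o f w v
  existsUnique_out : ∀ f, ∀ v ∈ (S.face f).verts, ∃! w, o f v w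
  opposite : ∀ f f' v w, f ≠ f' → o f v w → (S.face f').Adj v w → o f' w v

variable {o : S.F → S.V → S.V → Prop}

namespace IsOrientation

theorem isLinkOrientation_out (hS : S.IsClosed) (ho : S.IsOrientation o) (v : S.V) :
    S.IsLinkOrientation v fun f w => o f v w where
  adj h := (ho.adj_iff _ _ _).2 (Or.inl h)
  existsUnique_exit hv := ho.existsUnique_out _ v hv
  existsUnique_face {w} hw := by
    refine existsUnique_of_exists_of_unique ?_ fun f g hf hg => ?_
    · obtain ⟨f, hf⟩ := exists_face_adj hw
      obtain ⟨g, hg, hgf⟩ := Set.exists_ne_of_one_lt_ncard (one_lt_two.trans_eq (hS v w hw).symm) f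
      rcases (ho.adj_iff f v w).1 hf with h | h
      · exact ⟨f, h⟩
      · exact ⟨g, ho.opposite f g w v hgf.symm h (SimpleGraph.Subgraph.Adj.symm hg)⟩
    · by_contra hfg
      exact ho.asymm _ _ _ hg (ho.opposite f g v w hfg hf ((ho.adj_iff _ _ _).2 (Or.inl hg)))

theorem isLinkOrientation_in (hS : S.IsClosed) (ho : S.IsOrientation o) (v : S.V) :
    S.IsLinkOrientation v fun f w => o f w v := by
  convert (ho.isLinkOrientation_out hS v).reverse hS using 3 with f w
  rw [ho.adj_iff]
  exact ⟨fun h => ⟨Or.inr h, ho.asymm f w v h⟩, fun h => h.1.resolve_left h.2⟩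

end IsOrientation

/-- `xy` is a boundary edge of the cut open surface, directed from `x` to `y` by the face on which
it lies. -/
def BoundaryStep (o : S.F → S.V → S.V → Prop) (x y : CutVertex Γ) : Prop :=
  Γ.Adj x.base y.base ∧ ∃ f, o f x.base y.base ∧ f ∈ x.sector ∧ f ∈ y.sector

theorem biUnique_boundaryStep (hS : S.IsClosed) (ho : S.IsOrientation o) :
    Relator.BiUnique (BoundaryStep o : CutVertex Γ → CutVertex Γ → Prop) := by
  constructor
  · rintro x y z ⟨hx, f, hf, hfx, hfz⟩ ⟨hy, g, hg, hgy, hgz⟩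
    have he := ho.isLinkOrientation_in hS z.base
    obtain rfl := he.exit_cut_unique hS ((mem_sector_iff hfz).1 hgz) hf hx.symm hg hy.symm
    exact eq_of_mem (he.exit_unique hf hg) hfx hgy
  · rintro x y z ⟨hy, f, hf, hfx, hfy⟩ ⟨hz, g, hg, hgx, hgz⟩
    have he := ho.isLinkOrientation_out hS x.base
    obtain rfl := he.exit_cut_unique hS ((mem_sector_iff hfx).1 hgx) hf hy hg hz
    exact eq_of_mem (he.exit_unique hf hg) hfy hgz

theorem symmGen_boundaryStep (hS : S.IsClosed)
    (h2 : ∀ v ∈ Γ.verts, 2 ≤ (Γ.neighborSet v).ncard) (ho : S.IsOrientation o)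
    {C : (cutGraph Γ).ConnectedComponent} {x y : C} (h : (piece hS h2 C).boundary.Adj x y) :
    Relation.SymmGen (BoundaryStep o) x.1 y.1 := by
  obtain ⟨⟨f, hf, hx, hy⟩, hcut⟩ := (piece_boundary_adj_iff hS h2).1 h
  exact ((ho.adj_iff _ _ _).1 hf).imp (fun h => ⟨hcut, f, h, hx, hy⟩)
    fun h => ⟨hcut.symm, f, h, hy, hx⟩

-- Walking inwards from both ends: at a vertex of degree two in `Γ`, the edge by which one copy is
-- left is the edge by which the other copy is entered.
theorem base_eq_of_boundaryStep (hS : S.IsClosed)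
    (h2 : ∀ v ∈ Γ.verts, (Γ.neighborSet v).ncard = 2) (ho : S.IsOrientation o)
    {a b c d : CutVertex Γ} (hab : a.base = b.base) (hne : a ≠ b) (hac : BoundaryStep o a c)
    (hdb : BoundaryStep o d b) : c.base = d.base ∧ c ≠ d := by
  have hle : ∀ v ∈ Γ.verts, 2 ≤ (Γ.neighborSet v).ncard := fun v hv => (h2 v hv).ge
  obtain ⟨hac, f, hf, hfa, hfc⟩ := hac
  obtain ⟨hdb, g, hg, hgd, hgb⟩ := hdb
  have he := ho.isLinkOrientation_out hS b.base
  have hgb' : (S.face g).Adj d.base b.base := (ho.adj_iff _ _ _).2 (Or.inl hg)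
  rw [hab] at hac hf
  obtain ⟨k, hkb, w, hk, hw⟩ := exists_exit_cut hS he hac
  have hcw : c.base ≠ w := by
    rintro rfl
    exact hne (eq_of_mem hab hfa (he.face_unique hk hf ▸ hkb))
  have hdw : d.base ≠ w := by
    rintro rfl
    obtain rfl := face_unique hS hle hw (he.adj hk) hgb'.symm hkb hgb
    exact ho.asymm _ _ _ hk hg
  constructor
  · have hrest : ((Γ.neighborSet b.base) \ {w}).ncard = 1 := by
      rw [Set.ncard_sdiff_singleton_of_mem (show w ∈ Γ.neighborSet b.base from hw),
        h2 _ hdb.snd_mem]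
    obtain ⟨z, hz⟩ := Set.ncard_eq_one.1 hrest
    exact (hz.subset ⟨hac, hcw⟩).trans (hz.subset ⟨hdb.symm, hdw⟩).symm
  · rintro rfl
    obtain rfl := face_unique hS hle hdb (he.adj hf).symm hgb' hfc hgd
    exact ho.asymm _ _ _ hf hg

theorem eq_of_reflTransGen_boundaryStep (hS : S.IsClosed)
    (h2 : ∀ v ∈ Γ.verts, (Γ.neighborSet v).ncard = 2) (ho : S.IsOrientation o)
    {x y : CutVertex Γ} (h : Relation.ReflTransGen (BoundaryStep o) x y)
    (hxy : x.base = y.base) : x = y := by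
  by_contra hne
  exact not_rel_of_reflTransGen (opp := fun x y : CutVertex Γ => x.base = y.base ∧ x ≠ y)
    (fun _ h => h.2 rfl) (fun _ _ h h' => h.1.ne h'.1)
    (fun _ _ _ _ h => base_eq_of_boundaryStep hS h2 ho h.1 h.2) h ⟨hxy, hne⟩

theorem eq_of_piece_boundary_reachable (hS : S.IsClosed)
    (h2 : ∀ v ∈ Γ.verts, (Γ.neighborSet v).ncard = 2) (ho : S.IsOrientation o)
    {C : (cutGraph Γ).ConnectedComponent} {x y : C}
    (h : (piece hS (fun v hv => (h2 v hv).ge) C).boundary.Reachable x y)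
    (hxy : x.1.base = y.1.base) : x = y := by
  have hpath := ((SimpleGraph.reachable_iff_reflTransGen x y).1 h).lift Subtype.val
    fun _ _ => symmGen_boundaryStep hS (fun v hv => (h2 v hv).ge) ho
  refine Subtype.ext ?_
  rcases reflTransGen_total_of_biUnique (biUnique_boundaryStep hS ho) hpath with h | h
  · exact eq_of_reflTransGen_boundaryStep hS h2 ho h hxy
  · exact (eq_of_reflTransGen_boundaryStep hS h2 ho h hxy.symm).symm

end DiscreteSurface

theorem lemma3p2_general (S : DiscreteSurface.{u}) (hS : S.IsClosed) (Γ : S.G.Subgraph)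
    (h2 : ∀ v ∈ Γ.verts, 2 ≤ (Γ.neighborSet v).ncard) :
    ∃ (ι : Type u) (_ : Finite ι) (_ : Nonempty ι) (M : ι → DiscreteSurface.{u})
      (φ : ∀ i, (M i).V → S.V) (ψ : ∀ i, (M i).F → S.F),
      S.IsCutAlong Γ M φ ψ ∧
      (S.Orientable → (∀ v ∈ Γ.verts, (Γ.neighborSet v).ncard = 2) →
        ∀ i a b, (M i).boundary.Reachable a b → φ i a = φ i b → a = b) := by
  obtain ⟨f⟩ := S.nonempty_F
  refine ⟨(DiscreteSurface.cutGraph Γ).ConnectedComponent, inferInstanceAs (Finite (Quot _)),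
    ⟨DiscreteSurface.faceComponent Γ f⟩, DiscreteSurface.piece hS h2, _, _,
    DiscreteSurface.isCutAlong_piece hS h2, ?_⟩
  rintro ⟨o, hadj, hasymm, hout, hopp⟩ h2' C x y
  exact DiscreteSurface.eq_of_piece_boundary_reachable hS h2' ⟨hadj, hasymm, hout, hopp⟩

theorem lemma3p2 (S : DiscreteSurface.{u}) (g : ℕ) (hS : S.IsClosedOfGenus g)
    -- the sample points, the levels, and the values at the sample points and along the paths
    (J : Set S.V) {n : ℕ} (A : Fin n → ℝ) (hA : StrictMono A) (val : S.V → ℝ)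
    -- the paths, and the graph that they form together
    {κ : Type*} (src tgt : κ → S.V) (p : ∀ k, S.G.Walk (src k) (tgt k))
    (hp : ∀ k, IsGraduallyVariedPath A val (p k))
    (Γ : S.G.Subgraph) (hΓ : Γ = ⨆ k, (p k).toSubgraph)
    (hJ : J ⊆ Γ.verts)
    -- each path vertex has two path neighbours
    (h2 : ∀ v ∈ Γ.verts, 2 ≤ (Γ.neighborSet v).ncard) :
    ∃ (ι : Type u) (_ : Finite ι) (_ : Nonempty ι) (M : ι → DiscreteSurface.{u})
      (φ : ∀ i, (M i).V → S.V) (ψ : ∀ i, (M i).F → S.F),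
      S.IsCutAlong Γ M φ ψ ∧
      -- if there are exactly two, each boundary curve is mapped one-to-one (onto a path curve)
      ((∀ v ∈ Γ.verts, (Γ.neighborSet v).ncard = 2) →
        ∀ i a b, (M i).boundary.Reachable a b → φ i a = φ i b → a = b) := by
  obtain ⟨ι, hfin, hne, M, φ, ψ, hcut, hinj⟩ := lemma3p2_general S hS.1 Γ h2
  exact ⟨ι, hfin, hne, M, φ, ψ, hcut, hinj hS.2.1⟩
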